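/- Let $f\colon X\to Y$ be a continuous map between connected, locally path-connected, semilocally simply-connected topological spaces (no Hausdorff hypothesis; connected spaces are nonempty), let $x_0\in X$, and let $f_\sharp\colon\pi_1(X,x_0)\to\pi_1(Y,f(x_0))$ be the induced homomorphism. For a space $Z$, let $\mathrm{Cov}(Z)$ be the category whose objects are the covering maps $p\colon E\to Z$ ($E$ may be disconnected or empty) and whose morphisms from $p_1\colon E_1\to Z$ to $p_2\colon E_2\to Z$ are the continuous maps $t\colon E_1\to E_2$ with $p_2\circ t=p_1$. Let $f^*\colon\mathrm{Cov}(Y)\to\mathrm{Cov}(X)$ be the pullback functor, which sends $p\colon E\to Y$ to the first-coordinate projection $f^*(E)=\{(x,e)\in X\times E \mid f(x)=p(e)\}\to X$ and sends a morphism $t$ to the restriction of $\mathrm{id}_X\times t$. Then $f_\sharp$ is surjective if and only if $f^*$ is essentially injective, that is, for all coverings $E_1,E_2$ of $Y$, if $f^*(E_1)\cong f^*(E_2)$ in $\mathrm{Cov}(X)$, then $E_1\cong E_2$ in $\mathrm{Cov}(Y)$. -/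

import Mathlib

open CategoryTheory Topology

universe u

/-- Every point has a neighbourhood `U` such that each loop in `U` based at that point is
null-homotopic in the whole space, i.e. `π₁(U, x) → π₁(X, x)` is trivial. -/
class SemilocallySimplyConnectedSpace (X : Type u) [TopologicalSpace X] : Prop where
  exists_nhds_homotopic_refl : ∀ x : X, ∃ U ∈ 𝓝 x, ∀ γ : Path x x,
    Set.range γ ⊆ U → γ.Homotopic (Path.refl x)

/-- A covering of `Y`; the total space may be disconnected or empty. -/
structure Cov (Y : Type u) [TopologicalSpace Y] where
  total : Type u
  [top : TopologicalSpace total]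
  proj : total → Y
  isCoveringMap : IsCoveringMap proj

namespace Cov

attribute [instance] Cov.top

variable {X Y : Type u} [TopologicalSpace X] [TopologicalSpace Y]

/-- A morphism of coverings of `Y`: a continuous map of total spaces over `Y`. -/
@[ext]
structure Hom (E₁ E₂ : Cov Y) where
  map : C(E₁.total, E₂.total)
  comm : ∀ e, E₂.proj (map e) = E₁.proj e

instance : Category (Cov Y) where
  Hom := Hom
  id E := ⟨ContinuousMap.id _, fun _ => rfl⟩
  comp s t := ⟨t.map.comp s.map, fun e => (t.comm _).trans (s.comm e)⟩

/-- The total space `{(x, e) ∈ X × E | f x = p e}` of the pullback. -/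
abbrev PullbackTotal (f : C(X, Y)) (E : Cov Y) : Type u :=
  {z : X × E.total // f z.1 = E.proj z.2}

/-- The projection of the pullback to `X` is a covering map. -/
theorem isCoveringMap_pullback (f : C(X, Y)) (E : Cov Y) :
    IsCoveringMap (fun z : PullbackTotal f E => z.1.1) := by
  intro x
  obtain ⟨hd, U, hxU, hU, -, H, hH⟩ := E.isCoveringMap (f x)
  have hS : ∀ (y : U) (i : E.proj ⁻¹' {f x}), E.proj (H.symm (y, i)).1 = y.1 := by
    intro y i
    rw [← hH, H.apply_symm_apply]
  have key : IsEvenlyCovered (fun z : PullbackTotal f E => z.1.1) x (E.proj ⁻¹' {f x}) := by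
    refine ⟨hd, f ⁻¹' U, hxU, hU.preimage f.continuous,
      (hU.preimage f.continuous).preimage (continuous_fst.comp continuous_subtype_val),
      { toFun := fun z => (⟨z.1.1.1, z.2⟩, (H ⟨z.1.1.2, by
          have h : f z.1.1.1 ∈ U := z.2
          rwa [z.1.2] at h⟩).2)
        invFun := fun w => ⟨⟨(w.1.1, (H.symm (⟨f w.1.1, w.1.2⟩, w.2)).1), (hS ⟨f w.1.1, w.1.2⟩ w.2).symm⟩, w.1.2⟩
        left_inv := ?_
        right_inv := ?_
        continuous_toFun := by fun_prop
        continuous_invFun := by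
          have hc : Continuous fun w : (f ⁻¹' U) × (E.proj ⁻¹' {f x}) =>
              ((⟨f w.1.1, w.1.2⟩ : U), w.2) := by fun_prop
          exact ((continuous_subtype_val.comp continuous_fst).prodMk (continuous_subtype_val.comp
            (H.symm.continuous.comp hc))).subtype_mk _ |>.subtype_mk _ }, fun _ => rfl⟩
    · rintro ⟨⟨⟨a, e⟩, hae⟩, ha⟩
      have he : e ∈ E.proj ⁻¹' U := by
        have h : f a ∈ U := ha
        rwa [show f a = E.proj e from hae] at h
      have h1 : ((⟨f a, ha⟩ : U), (H ⟨e, he⟩).2) = H ⟨e, he⟩ :=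
        Prod.ext (Subtype.ext (by rw [hH]; exact hae)) rfl
      apply Subtype.ext
      apply Subtype.ext
      apply Prod.ext
      · rfl
      · change (H.symm ((⟨f a, ha⟩ : U), (H ⟨e, he⟩).2)).1 = e
        rw [h1, H.symm_apply_apply]
    · rintro ⟨⟨a, ha⟩, i⟩
      apply Prod.ext
      · rfl
      · change (H (H.symm (⟨f a, ha⟩, i))).2 = i
        rw [H.apply_symm_apply]
  exact key.to_isEvenlyCovered_preimage

/-- The topological pullback functor `f^* : Cov Y ⥤ Cov X`. -/
def pullback (f : C(X, Y)) : Cov Y ⥤ Cov X where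
  obj E := ⟨PullbackTotal f E, fun z => z.1.1, isCoveringMap_pullback f E⟩
  map {E₁ E₂} t :=
    { map :=
        { toFun := fun z : PullbackTotal f E₁ =>
            (⟨(z.1.1, Hom.map t z.1.2), z.2.trans (Hom.comm t z.1.2).symm⟩ : PullbackTotal f E₂)
          continuous_toFun := by fun_prop }
      comm := fun _ => rfl }

end Cov

/-- A functor is essentially injective if `F x ≅ F y` implies `x ≅ y`. -/
def EssentiallyInjective {C D : Type*} [Category C] [Category D] (F : C ⥤ D) : Prop :=
  ∀ x y : C, Nonempty (F.obj x ≅ F.obj y) → Nonempty (x ≅ y)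

/-!
Taking fibres with their monodromy identifies `Cov Y` with the functors from the fundamental
groupoid of `Y` to sets, and turns `f^*` into restriction along the functor `φ` induced by `f` on
fundamental groupoids. Surjectivity of `f_♯` means that `φ` is full. In that case restriction along
`φ`, which is also essentially surjective, is fully faithful and hence essentially injective.

Conversely, let `F` be the functor of cosets of the image of `f_♯`. The restriction of `F` along
`φ` has a section `s`, and Hilbert's hotel along `{s} × ℕ` gives `φ^*(F × ℕ) ≅ φ^*(F × ℕ ⊔ 1)`.
Essential injectivity descends this to `F × ℕ ≅ F × ℕ ⊔ 1`, so `F` itself has a section, i.e. some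
coset is fixed by `π₁(Y)`, which forces the image of `f_♯` to be everything.
-/

universe v w

section Category

theorem EssentiallyInjective.of_full_faithful {C D : Type*} [Category C] [Category D] (F : C ⥤ D)
    [F.Full] [F.Faithful] : EssentiallyInjective F :=
  fun _ _ ⟨e⟩ => ⟨F.preimageIso e⟩

theorem essentiallyInjective_iff_of_comp_iso {C D C' D' : Type*} [Category C] [Category D]
    [Category C'] [Category D'] {P : C ⥤ D} {Q : C' ⥤ D'} {F : C ⥤ C'} {G : D ⥤ D'}
    [F.IsEquivalence] [G.Full] [G.Faithful] (e : P ⋙ G ≅ F ⋙ Q) :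
    EssentiallyInjective P ↔ EssentiallyInjective Q := by
  constructor
  · rintro hP x y ⟨i⟩
    let j : Q.obj (F.obj (F.objPreimage x)) ≅ Q.obj (F.obj (F.objPreimage y)) :=
      Q.mapIso (F.objObjPreimageIso x) ≪≫ i ≪≫ (Q.mapIso (F.objObjPreimageIso y)).symm
    obtain ⟨k⟩ := hP _ _ ⟨G.preimageIso (e.app _ ≪≫ j ≪≫ (e.app _).symm)⟩
    exact ⟨(F.objObjPreimageIso x).symm ≪≫ F.mapIso k ≪≫ F.objObjPreimageIso y⟩
  · rintro hQ x y ⟨i⟩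
    obtain ⟨k⟩ := hQ _ _ ⟨(e.app x).symm ≪≫ G.mapIso i ≪≫ e.app y⟩
    exact ⟨F.preimageIso k⟩

variable {G H C : Type*} [Category G] [Category H] [Category C]

theorem full_whiskeringLeft (φ : G ⥤ H) [φ.Full] [φ.EssSurj] :
    ((Functor.whiskeringLeft G H C).obj φ).Full where
  map_surjective {F F'} τ := by
    let i (y : H) := φ.objObjPreimageIso y
    have naturality {x x' : G} (g : φ.obj x ⟶ φ.obj x') :
        F.map g ≫ τ.app x' = τ.app x ≫ F'.map g := by
      rw [← φ.map_preimage g]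
      exact τ.naturality (φ.preimage g)
    refine ⟨{ app := fun y => F.map (i y).inv ≫ τ.app _ ≫ F'.map (i y).hom
              naturality := fun y y' h => ?_ }, ?_⟩
    · simpa using
        F.map (i y).inv ≫= naturality ((i y).hom ≫ h ≫ (i y').inv) =≫ F'.map (i y').hom
    · ext x
      simpa using F.map (i (φ.obj x)).inv ≫= (naturality (i (φ.obj x)).hom).symm

theorem faithful_whiskeringLeft (φ : G ⥤ H) [φ.EssSurj] :
    ((Functor.whiskeringLeft G H C).obj φ).Faithful where
  map_injective {F F'} σ τ h := by
    ext y
    rw [← cancel_epi (F.map (φ.objObjPreimageIso y).hom), σ.naturality, τ.naturality]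
    exact congr_app h (φ.objPreimage y) =≫ F'.map (φ.objObjPreimageIso y).hom

end Category

section Groupoid

theorem full_iff_surjective_map_loops {G H : Type*} [Groupoid G] [IsPreconnected G] [Category H]
    (φ : G ⥤ H) (x₀ : G) :
    φ.Full ↔ Function.Surjective (φ.map : (x₀ ⟶ x₀) → (φ.obj x₀ ⟶ φ.obj x₀)) := by
  refine ⟨fun _ => φ.map_surjective, fun hφ => ⟨fun {x y} h => ?_⟩⟩
  obtain ⟨c⟩ : Nonempty (x₀ ⟶ x) := inferInstance
  obtain ⟨d⟩ : Nonempty (x₀ ⟶ y) := inferInstance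
  obtain ⟨l, hl⟩ := hφ (φ.map c ≫ h ≫ φ.map (inv d))
  exact ⟨inv c ≫ l ≫ d, by simp [hl]⟩

theorem essSurj_of_isPreconnected {G H : Type*} [Category G] [Nonempty G] [Groupoid H]
    [IsPreconnected H] (φ : G ⥤ H) : φ.EssSurj where
  mem_essImage y := by
    obtain ⟨x⟩ := ‹Nonempty G›
    obtain ⟨h⟩ : Nonempty (φ.obj x ⟶ y) := inferInstance
    exact ⟨x, ⟨asIso h⟩⟩

end Groupoid

section Sections

/-- The functor `S ↦ S × ℕ`, which makes room for one further point as soon as `S` is nonempty. -/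
def prodNat : Type w ⥤ Type w where
  obj S := S × ℕ
  map m := ↾Prod.map m id

open scoped Classical in
/-- The Hilbert hotel bijection splitting off one point from `S × ℕ` by a shift along
`{s₀} × ℕ`. -/
noncomputable def prodNatEquivOption {S : Type*} (s₀ : S) : S × ℕ ≃ Option (S × ℕ) where
  toFun z := if z.1 = s₀ then (if z.2 = 0 then none else some (z.1, z.2 - 1)) else some z
  invFun
    | none => (s₀, 0)
    | some z => if z.1 = s₀ then (z.1, z.2 + 1) else z
  left_inv z := by grind
  right_inv z := by rcases z with _ | z <;> grind

theorem prodNatEquivOption_map {S T : Type*} {m : S → T} (hm : m.Injective) (s₀ : S) (z : S × ℕ) :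
    prodNatEquivOption (m s₀) (Prod.map m id z) =
      (prodNatEquivOption s₀ z).map (Prod.map m id) := by
  by_cases h : z.1 = s₀ <;> by_cases h' : z.2 = 0 <;>
    simp [prodNatEquivOption, hm.eq_iff, h, h']

/-- Over a groupoid, the Hilbert hotel bijections at the values of a section are natural. -/
noncomputable def prodNatIsoOption {G : Type*} [Groupoid G] {F : G ⥤ Type w} (s : F.sections) :
    F ⋙ prodNat ≅ F ⋙ prodNat ⋙ ofTypeFunctor Option :=
  NatIso.ofComponents (fun x => (prodNatEquivOption (s.1 x)).toIso) fun {x y} g => by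
    ext z
    have hg : Function.Injective (F.map g) := ((isIso_iff_bijective _).mp inferInstance).1
    have := prodNatEquivOption_map hg (s.1 x) z
    rw [s.2 g] at this
    exact this

theorem EssentiallyInjective.nonempty_sections {G H : Type*} [Groupoid G] [Category H] {φ : G ⥤ H}
    (hφ : EssentiallyInjective ((Functor.whiskeringLeft G H (Type w)).obj φ)) {F : H ⥤ Type w}
    (s : (φ ⋙ F).sections) : Nonempty F.sections := by
  obtain ⟨i⟩ := hφ (F ⋙ prodNat) (F ⋙ prodNat ⋙ ofTypeFunctor Option) ⟨prodNatIsoOption s⟩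
  let noneSection : (F ⋙ prodNat ⋙ ofTypeFunctor Option).sections := ⟨fun _ => none, fun _ => rfl⟩
  let t : (F ⋙ prodNat).sections := (Functor.sectionsFunctor H).map i.inv noneSection
  exact ⟨⟨fun y => (t.1 y).1, fun h => congrArg Prod.fst (t.2 h)⟩⟩

end Sections

section Cosets

variable {G : Type*} [Groupoid G]

/-- The morphisms `φ.obj x₀ ⟶ y` up to precomposition with the images of the endomorphisms
of `x₀`. -/
def cosetSetoid {H : Type*} [Category H] (φ : G ⥤ H) (x₀ : G) (y : H) :
    Setoid (φ.obj x₀ ⟶ y) where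
  r γ δ := ∃ l : x₀ ⟶ x₀, φ.map l ≫ γ = δ
  iseqv :=
    { refl := fun γ => ⟨𝟙 x₀, by simp⟩
      symm := by
        rintro γ _ ⟨l, rfl⟩
        exact ⟨inv l, by simp⟩
      trans := by
        rintro γ _ _ ⟨l, rfl⟩ ⟨l', rfl⟩
        exact ⟨l' ≫ l, by simp⟩ }

/-- The functor `y ↦ Aut x₀ \ (φ.obj x₀ ⟶ y)`; for a functor between connected groupoids it is the
covering with stabiliser the image of `Aut x₀`. -/
def cosetFunctor {H : Type*} [Category.{v} H] (φ : G ⥤ H) (x₀ : G) : H ⥤ Type v where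
  obj y := Quotient (cosetSetoid φ x₀ y)
  map δ := ↾Quotient.map (· ≫ δ) (by
    rintro γ _ ⟨l, rfl⟩
    exact ⟨l, by simp⟩)
  map_id y := by
    ext ⟨γ⟩
    exact congrArg (Quotient.mk _) (Category.comp_id γ)
  map_comp δ ε := by
    ext ⟨γ⟩
    exact congrArg (Quotient.mk _) (Category.assoc γ δ ε).symm

theorem nonempty_sections_comp_cosetFunctor [IsPreconnected G] {H : Type*} [Category H] (φ : G ⥤ H)
    (x₀ : G) : Nonempty (φ ⋙ cosetFunctor φ x₀).sections := by
  let c (x : G) : x₀ ⟶ x := Classical.choice inferInstance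
  refine ⟨⟨fun x => Quotient.mk _ (φ.map (c x)), fun {x y} g => Quotient.sound ?_⟩⟩
  exact ⟨c y ≫ inv g ≫ inv (c x), by simp⟩

theorem surjective_map_loops_of_section_cosetFunctor {H : Type*} [Groupoid H] {φ : G ⥤ H} {x₀ : G}
    (s : (cosetFunctor φ x₀).sections) :
    Function.Surjective (φ.map : (x₀ ⟶ x₀) → (φ.obj x₀ ⟶ φ.obj x₀)) := by
  intro g
  obtain ⟨c, hc⟩ := Quotient.exists_rep (s.1 (φ.obj x₀))
  have fixed := s.2 (inv c ≫ g ≫ c)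
  rw [← hc] at fixed
  obtain ⟨l, hl⟩ : ∃ l, φ.map l ≫ c = c ≫ inv c ≫ g ≫ c := Quotient.exact fixed.symm
  exact ⟨l, (cancel_mono c).mp (by simpa using hl)⟩

theorem essentiallyInjective_whiskeringLeft_iff_full [IsConnected G] {H : Type*} [Groupoid.{w} H]
    [IsPreconnected H] (φ : G ⥤ H) :
    EssentiallyInjective ((Functor.whiskeringLeft G H (Type w)).obj φ) ↔ φ.Full := by
  constructor
  · intro hφ
    obtain ⟨x₀⟩ : Nonempty G := inferInstance
    obtain ⟨s⟩ := nonempty_sections_comp_cosetFunctor φ x₀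
    obtain ⟨t⟩ := hφ.nonempty_sections s
    exact (full_iff_surjective_map_loops φ x₀).mpr (surjective_map_loops_of_section_cosetFunctor t)
  · intro _
    have := essSurj_of_isPreconnected φ
    have := full_whiskeringLeft (C := Type w) φ
    have := faithful_whiskeringLeft (C := Type w) φ
    exact .of_full_faithful _

end Cosets

open Path.Homotopic (Quotient)

section Monodromy

variable {E E' X Y : Type*} [TopologicalSpace E] [TopologicalSpace E'] [TopologicalSpace X]
  [TopologicalSpace Y]

theorem map_monodromy {p : E → X} {q : E' → Y} (hp : IsCoveringMap p) (hq : IsCoveringMap q)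
    (f : C(X, Y)) (g : C(E, E')) (hfg : ∀ e, q (g e) = f (p e)) {x x' : X} (γ : Quotient x x')
    (e : p ⁻¹' {x}) :
    g (hp.monodromy γ e) =
      hq.monodromy (γ.map f) ⟨g e, (hfg e).trans (congrArg f e.2)⟩ := by
  induction γ with | mk γ =>
  have h₀ : γ 0 = p e := γ.source.trans e.2.symm
  have lift : g ∘ hp.liftPath γ e h₀ = hq.liftPath (γ.map f.continuous) (g e)
      ((congrArg f h₀).trans (hfg e).symm) := by
    refine (hq.eq_liftPath_iff _).mpr ⟨by fun_prop, funext fun t => ?_, ?_⟩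
    · exact (hfg _).trans (congrArg f (congrFun (hp.liftPath_lifts γ e h₀) t))
    · exact congrArg g (hp.liftPath_zero γ e h₀)
  exact congrFun lift 1

theorem locallyPathConnectedSpace_of_isLocalHomeomorph [LocallyPathConnectedSpace Y] {p : E → Y}
    (hp : IsLocalHomeomorph p) : LocallyPathConnectedSpace E := by
  choose φ hφ using hp
  let _ : ChartedSpace Y E :=
    { atlas := Set.range φ
      chartAt := φ
      mem_chart_source := fun e => (hφ e).1
      chart_mem_atlas := Set.mem_range_self }
  exact ChartedSpace.locallyPathConnectedSpace Y E

theorem monodromy_eq_symm_of_forall_mem_target {p : E → Y} (hp : IsCoveringMap p)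
    {φ : OpenPartialHomeomorph E Y} (hφ : p = φ) {e : E} (he : e ∈ φ.source) {y : Y}
    (γ : Path (p e) y) (hγ : ∀ t, γ t ∈ φ.target) :
    (hp.monodromy (.mk γ) ⟨e, rfl⟩).1 = φ.symm y := by
  have lift : φ.symm ∘ γ = hp.liftPath γ e γ.source := by
    refine (hp.eq_liftPath_iff _).mpr ⟨?_, funext fun t => ?_, ?_⟩
    · exact φ.continuousOn_symm.comp_continuous γ.continuous hγ
    · exact (congrFun hφ _).trans (φ.right_inv (hγ t))
    · simpa [hφ] using φ.left_inv he
  exact (congrFun lift 1).symm.trans (congrArg φ.symm γ.target)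

theorem isOpen_iff_monodromy_mem [LocallyPathConnectedSpace Y] {p : E → Y} (hp : IsCoveringMap p)
    {V : Set E} :
    IsOpen V ↔ ∀ (y : Y) (e : p ⁻¹' {y}), e.1 ∈ V → ∃ W ∈ 𝓝 y, ∀ (y' : Y) (γ : Path y y'),
      (∀ t, γ t ∈ W) → (hp.monodromy (.mk γ) e).1 ∈ V := by
  constructor
  · rintro hV _ ⟨e, rfl⟩ he
    obtain ⟨φ, heφ, hφ⟩ := hp.isLocalHomeomorph e
    have hW : φ '' (φ.source ∩ V) ∈ 𝓝 (p e) :=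
      (φ.isOpen_image_source_inter hV).mem_nhds ⟨e, ⟨heφ, he⟩, (congrFun hφ e).symm⟩
    refine ⟨_, hW, fun y' γ hγ => ?_⟩
    have hγφ (t) : γ t ∈ φ.target := Set.image_subset_iff.mpr (fun _ h => φ.map_source h.1) (hγ t)
    obtain ⟨e', ⟨he'φ, he'⟩, rfl⟩ : y' ∈ φ '' (φ.source ∩ V) := by simpa using hγ 1
    rwa [monodromy_eq_symm_of_forall_mem_target hp hφ heφ γ hγφ, φ.left_inv he'φ]
  · intro hV
    have := locallyPathConnectedSpace_of_isLocalHomeomorph hp.isLocalHomeomorph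
    refine isOpen_iff_mem_nhds.mpr fun e he => ?_
    obtain ⟨W, hW, H⟩ := hV _ ⟨e, rfl⟩ he
    filter_upwards [pathComponentIn_mem_nhds (hp.continuous.continuousAt hW)] with e' ⟨η, hη⟩
    have := H _ (η.map hp.continuous) hη
    rwa [show hp.monodromy (.mk (η.map hp.continuous)) ⟨e, rfl⟩ = ⟨e', rfl⟩ from
      hp.monodromy_map (.mk η)] at this

end Monodromy

namespace Cov

variable {X Y : Type u} [TopologicalSpace X] [TopologicalSpace Y]

/-- The functor sending a covering of `Y` to its fibres, with the monodromy action of the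
fundamental groupoid. -/
noncomputable def monodromy (Y : Type u) [TopologicalSpace Y] :
    Cov Y ⥤ FundamentalGroupoid Y ⥤ Type u where
  obj E := E.isCoveringMap.monodromyFunctor
  map {E₁ E₂} t :=
    { app := fun y => ↾fun e : E₁.proj ⁻¹' {y.as} =>
        (⟨Hom.map t e, (Hom.comm t e).trans e.2⟩ : E₂.proj ⁻¹' {y.as})
      naturality := fun y y' γ => by
        obtain ⟨γ⟩ := γ
        ext e
        exact Subtype.ext <| map_monodromy E₁.isCoveringMap E₂.isCoveringMap (.id Y) (Hom.map t)
          (Hom.comm t) (.mk γ) e }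

instance : (monodromy Y).Faithful where
  map_injective {E₁ E₂ s t} h := by
    refine Hom.ext (ContinuousMap.ext fun e => ?_)
    exact congrArg Subtype.val
      (ConcreteCategory.congr_hom (congr_app h ⟨E₁.proj e⟩) (⟨e, rfl⟩ : E₁.proj ⁻¹' {E₁.proj e}))

instance [LocallyPathConnectedSpace Y] : (monodromy Y).Full where
  map_surjective {E₁ E₂} τ := by
    let t (e : E₁.total) : E₂.proj ⁻¹' {E₁.proj e} := τ.app ⟨E₁.proj e⟩ ⟨e, rfl⟩
    have ht {y : Y} (e : E₁.proj ⁻¹' {y}) : (t e).1 = (τ.app ⟨y⟩ e).1 := by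
      obtain ⟨e, rfl⟩ := e
      rfl
    have continuous_t : Continuous fun e => (t e).1 := by
      refine continuous_def.mpr fun V hV => (isOpen_iff_monodromy_mem E₁.isCoveringMap).mpr ?_
      intro y e he
      obtain ⟨W, hW, H⟩ := (isOpen_iff_monodromy_mem E₂.isCoveringMap).mp hV y (τ.app ⟨y⟩ e)
        (ht e ▸ he)
      refine ⟨W, hW, fun y' γ hγ => ?_⟩
      have equivariant : τ.app ⟨y'⟩ (E₁.isCoveringMap.monodromy (.mk γ) e) =
          E₂.isCoveringMap.monodromy (.mk γ) (τ.app ⟨y⟩ e) :=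
        NatTrans.naturality_apply τ (X := ⟨y⟩) (Y := ⟨y'⟩) (.mk γ) e
      rw [Set.mem_preimage, ht, equivariant]
      exact H y' γ hγ
    refine ⟨⟨⟨_, continuous_t⟩, fun e => (t e).2⟩, ?_⟩
    ext y e
    exact Subtype.ext (ht e)

/-- The fibre of `f^* E` over `x` is the fibre of `E` over `f x`. -/
def pullbackFiberEquiv (f : C(X, Y)) (E : Cov Y) (x : X) :
    ((pullback f).obj E).proj ⁻¹' {x} ≃ E.proj ⁻¹' {f x} where
  toFun z := ⟨z.1.1.2, z.1.2.symm.trans (congrArg f z.2)⟩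
  invFun e := ⟨(⟨(x, e.1), e.2.symm⟩ : PullbackTotal f E), rfl⟩
  left_inv := by
    rintro ⟨⟨⟨x, e⟩, h⟩, rfl⟩
    rfl
  right_inv _ := rfl

/-- The monodromy of a pullback along `f` is the restriction of the monodromy along `f_♯`. -/
noncomputable def pullbackCompMonodromyIso (f : C(X, Y)) :
    pullback f ⋙ monodromy X ≅
      monodromy Y ⋙ (Functor.whiskeringLeft _ _ _).obj (FundamentalGroupoid.map f) :=
  NatIso.ofComponents
    (fun E => NatIso.ofComponents (fun x => (pullbackFiberEquiv f E x.as).toIso) fun {x x'} γ => by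
      ext z
      let g : C(PullbackTotal f E, E.total) := ⟨fun z => z.1.2, by fun_prop⟩
      exact Subtype.ext <| map_monodromy (isCoveringMap_pullback f E) E.isCoveringMap f g
        (fun z => z.2.symm) γ z)
    fun t => rfl

end Cov

/-- A local system of sets on `Y`: a functor from the fundamental groupoid of `Y` to sets. -/
abbrev LocalSystem (Y : Type u) [TopologicalSpace Y] := FundamentalGroupoid Y ⥤ Type u

namespace LocalSystem

variable {Y : Type u} [TopologicalSpace Y] (F : LocalSystem Y)

/-- The transport of a local system along a homotopy class of paths. -/
def transport {y y' : Y} (γ : Quotient y y') : F.obj ⟨y⟩ → F.obj ⟨y'⟩ :=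
  F.map (X := ⟨y⟩) (Y := ⟨y'⟩) γ

theorem transport_refl {y : Y} (a : F.obj ⟨y⟩) : F.transport (.refl y) a = a :=
  F.map_id_apply _ a

theorem transport_trans {y y' y'' : Y} (γ : Quotient y y') (δ : Quotient y' y'') (a : F.obj ⟨y⟩) :
    F.transport (γ.trans δ) a = F.transport δ (F.transport γ a) :=
  F.map_comp_apply (X := ⟨y⟩) (Y := ⟨y'⟩) (Z := ⟨y''⟩) γ δ a

theorem transport_symm_transport {y y' : Y} (γ : Quotient y y') (a : F.obj ⟨y⟩) :
    F.transport γ.symm (F.transport γ a) = a := by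
  rw [← transport_trans, Quotient.trans_symm, transport_refl]

theorem transport_transport_symm {y y' : Y} (γ : Quotient y y') (a : F.obj ⟨y'⟩) :
    F.transport γ (F.transport γ.symm a) = a := by
  rw [← transport_trans, Quotient.symm_trans, transport_refl]

theorem transport_symm_eq_iff {y y' : Y} {γ : Quotient y y'} {a : F.obj ⟨y⟩} {b : F.obj ⟨y'⟩} :
    F.transport γ.symm b = a ↔ b = F.transport γ a := by
  constructor
  · rintro rfl
    exact (F.transport_transport_symm γ b).symm
  · rintro rfl
    exact F.transport_symm_transport γ a

/-- The total space of a local system. -/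
structure Total : Type u where
  base : Y
  val : F.obj ⟨base⟩

/-- The fibres of the total space of a local system are its values. -/
def fiberEquiv (y : Y) : (Total.base : F.Total → Y) ⁻¹' {y} ≃ F.obj ⟨y⟩ where
  toFun z := cast (congrArg (fun b => F.obj ⟨b⟩) z.2) z.1.val
  invFun a := ⟨⟨y, a⟩, rfl⟩
  left_inv := by
    rintro ⟨⟨y, a⟩, rfl⟩
    rfl
  right_inv _ := rfl

variable {F}

/-- A set is open if it is stable under transport of each of its points along all sufficiently
small paths; by `isOpen_iff_monodromy_mem` no other topology makes a covering with monodromy `F`. -/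
instance : TopologicalSpace F.Total where
  IsOpen V := ∀ (y : Y) (a : F.obj ⟨y⟩), ⟨y, a⟩ ∈ V → ∃ W ∈ 𝓝 y, ∀ (y' : Y) (γ : Path y y'),
    (∀ t, γ t ∈ W) → ⟨y', F.transport (.mk γ) a⟩ ∈ V
  isOpen_univ _ _ _ := ⟨Set.univ, Filter.univ_mem, fun _ _ _ => trivial⟩
  isOpen_inter V V' hV hV' y a h := by
    obtain ⟨W, hW, H⟩ := hV y a h.1
    obtain ⟨W', hW', H'⟩ := hV' y a h.2
    exact ⟨W ∩ W', Filter.inter_mem hW hW', fun y' γ hγ =>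
      ⟨H y' γ fun t => (hγ t).1, H' y' γ fun t => (hγ t).2⟩⟩
  isOpen_sUnion S hS y a h := by
    obtain ⟨V, hV, hm⟩ := h
    obtain ⟨W, hW, H⟩ := hS V hV y a hm
    exact ⟨W, hW, fun y' γ hγ => ⟨V, hV, H y' γ hγ⟩⟩

theorem isOpen_total_iff {V : Set F.Total} :
    IsOpen V ↔ ∀ (y : Y) (a : F.obj ⟨y⟩), ⟨y, a⟩ ∈ V → ∃ W ∈ 𝓝 y, ∀ (y' : Y) (γ : Path y y'),
      (∀ t, γ t ∈ W) → ⟨y', F.transport (.mk γ) a⟩ ∈ V :=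
  Iff.rfl

theorem continuous_base : Continuous (Total.base : F.Total → Y) :=
  continuous_def.mpr fun U hU => isOpen_total_iff.mpr fun _ _ h =>
    ⟨U, hU.mem_nhds h, fun y' γ hγ => by simpa using! hγ 1⟩

theorem continuous_mk_of_flat {A : Type*} [TopologicalSpace A] [LocallyPathConnectedSpace A]
    {q : A → Y} (hq : Continuous q) (s : ∀ a, F.obj ⟨q a⟩)
    (flat : ∀ (a b : A) (η : Path a b), F.transport (.mk (η.map hq)) (s a) = s b) :
    Continuous fun a => (⟨q a, s a⟩ : F.Total) := by
  refine continuous_def.mpr fun V hV => isOpen_iff_mem_nhds.mpr fun a ha => ?_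
  obtain ⟨W, hW, H⟩ := isOpen_total_iff.mp hV _ _ ha
  filter_upwards [pathComponentIn_mem_nhds (hq.continuousAt hW)] with b ⟨η, hη⟩
  have := H _ (η.map hq) hη
  rwa [flat] at this

section Trivialization

variable {y : Y} {U : Set Y} (c : ∀ y' : U, Quotient y y'.1)

variable (F) in
/-- The trivialisation of the total space over `U` given by transport along path classes `c` from
`y` to the points of `U`. -/
def trivializationEquiv : (Total.base : F.Total → Y) ⁻¹' U ≃ U × F.obj ⟨y⟩ where
  toFun z := (⟨z.1.base, z.2⟩, F.transport (c ⟨z.1.base, z.2⟩).symm z.1.val)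
  invFun w := ⟨⟨w.1.1, F.transport (c w.1) w.2⟩, w.1.2⟩
  left_inv _ := Subtype.ext (congrArg (Total.mk _) (F.transport_transport_symm _ _))
  right_inv _ := Prod.ext rfl (F.transport_symm_transport _ _)

variable {c} (hU : IsOpen U) (hc : ∀ (y' y'' : U) (γ : Path y'.1 y''.1), (∀ t, γ t ∈ U) →
  (c y').trans (.mk γ) = c y'')
include hU hc

theorem isOpen_setOf_eq_transport (a : F.obj ⟨y⟩) :
    IsOpen {z : F.Total | ∃ h : z.base ∈ U, z.val = F.transport (c ⟨z.base, h⟩) a} := by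
  rw [isOpen_total_iff]
  rintro y' b ⟨hy' : y' ∈ U, hb : b = F.transport (c ⟨y', hy'⟩) a⟩
  subst hb
  refine ⟨U, hU.mem_nhds hy', fun y'' γ hγ => ?_⟩
  have hy'' : y'' ∈ U := by simpa using hγ 1
  exact ⟨hy'', by rw [← hc ⟨y', hy'⟩ ⟨y'', hy''⟩ γ hγ, transport_trans]⟩

variable [TopologicalSpace (F.obj ⟨y⟩)] [DiscreteTopology (F.obj ⟨y⟩)]

theorem continuous_trivializationEquiv : Continuous (trivializationEquiv F c) := by
  refine ((continuous_base.comp continuous_subtype_val).subtype_mk _).prodMk ?_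
  refine continuous_discrete_rng.mpr fun a => ?_
  convert (isOpen_setOf_eq_transport hU hc a).preimage continuous_subtype_val
  ext ⟨⟨y', b⟩, hy'⟩
  exact F.transport_symm_eq_iff.trans ⟨fun h => ⟨hy', h⟩, fun h => h.2⟩

theorem continuous_trivializationEquiv_symm [LocallyPathConnectedSpace Y] :
    Continuous (trivializationEquiv F c).symm := by
  refine Continuous.subtype_mk (continuous_prod_of_discrete_right.mpr fun a => ?_) _
  have : LocallyPathConnectedSpace U := hU.locallyPathConnectedSpace
  refine continuous_mk_of_flat continuous_subtype_val (fun y' => F.transport (c y') a)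
    fun y' y'' η => ?_
  rw [← transport_trans, hc _ _ _ fun t => (η t).2]

end Trivialization

theorem exists_isOpen_trans_eq [LocallyPathConnectedSpace Y] [SemilocallySimplyConnectedSpace Y]
    (y : Y) : ∃ U : Set Y, IsOpen U ∧ y ∈ U ∧ ∃ c : ∀ y' : U, Quotient y y'.1,
      ∀ (y' y'' : U) (γ : Path y'.1 y''.1), (∀ t, γ t ∈ U) → (c y').trans (.mk γ) = c y'' := by
  obtain ⟨U₀, hU₀, hloop⟩ := SemilocallySimplyConnectedSpace.exists_nhds_homotopic_refl y
  obtain ⟨U, ⟨hU, hyU, hpc⟩, hUU₀⟩ := (isOpen_isPathConnected_basis y).mem_iff.mp hU₀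
  have joined (y' : U) : JoinedIn U y y' := hpc.joinedIn y hyU y' y'.2
  refine ⟨U, hU, hyU, fun y' => .mk (joined y').somePath, fun y' y'' γ hγ => ?_⟩
  let loop : Path y y := ((joined y').somePath.trans γ).trans (joined y'').somePath.symm
  have hloopU : Set.range loop ⊆ U := by
    simp only [loop, Path.trans_range, Path.symm_range, Set.union_subset_iff, Set.range_subset_iff]
    exact ⟨⟨(joined y').somePath_mem, hγ⟩, (joined y'').somePath_mem⟩
  let δ' : Quotient y y' := .mk (joined y').somePath
  let δ'' : Quotient y y'' := .mk (joined y'').somePath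
  have null : (δ'.trans (.mk γ)).trans δ''.symm = .refl y :=
    Quotient.eq.mpr (hloop loop (hloopU.trans hUU₀))
  calc δ'.trans (.mk γ) = ((δ'.trans (.mk γ)).trans δ''.symm).trans δ'' := by simp
    _ = δ'' := by rw [null, Quotient.refl_trans]

variable [LocallyPathConnectedSpace Y] [SemilocallySimplyConnectedSpace Y]

theorem isCoveringMap_base : IsCoveringMap (Total.base : F.Total → Y) := by
  intro y
  obtain ⟨U, hU, hyU, c, hc⟩ := exists_isOpen_trans_eq y
  let _ : TopologicalSpace (F.obj ⟨y⟩) := ⊥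
  have : DiscreteTopology (F.obj ⟨y⟩) := ⟨rfl⟩
  let H : (Total.base : F.Total → Y) ⁻¹' U ≃ₜ U × F.obj ⟨y⟩ :=
    { trivializationEquiv F c with
      continuous_toFun := continuous_trivializationEquiv hU hc
      continuous_invFun := continuous_trivializationEquiv_symm hU hc }
  have evenlyCovered : IsEvenlyCovered (Total.base : F.Total → Y) y (F.obj ⟨y⟩) :=
    ⟨inferInstance, U, hyU, hU, hU.preimage continuous_base, H, fun _ => rfl⟩
  exact evenlyCovered.to_isEvenlyCovered_preimage

theorem monodromy_mk {y y' : Y} (γ : Quotient y y') (a : F.obj ⟨y⟩) :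
    isCoveringMap_base.monodromy γ ⟨⟨y, a⟩, rfl⟩ = ⟨⟨y', F.transport γ a⟩, rfl⟩ := by
  have : LocallyPathConnectedSpace unitInterval := (convex_Icc (0 : ℝ) 1).locallyPathConnectedSpace
  have : ContractibleSpace unitInterval := (convex_Icc (0 : ℝ) 1).contractibleSpace ⟨0, by simp⟩
  induction γ with | mk γ =>
  obtain ⟨γ, rfl, rfl⟩ := γ
  let c (t : unitInterval) : Quotient 0 t := .mk (PathConnectedSpace.somePath 0 t)
  let s (t : unitInterval) : F.obj ⟨γ t⟩ := F.transport ((c t).map γ) a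
  have continuous_s : Continuous fun t => (⟨γ t, s t⟩ : F.Total) := by
    refine continuous_mk_of_flat γ.continuous s fun t t' δ => ?_
    have map_trans : ((c t).trans (.mk δ)).map γ = ((c t).map γ).trans (.mk (δ.map γ.continuous)) :=
      (FundamentalGroupoid.map γ).map_comp (X := ⟨0⟩) (Y := ⟨t⟩) (Z := ⟨t'⟩) (c t) (.mk δ)
    rw [← transport_trans, ← map_trans, Subsingleton.elim ((c t).trans (.mk δ)) (c t')]
  have s_zero : s 0 = a := by
    simp only [s]
    rw [Subsingleton.elim (c 0) (.refl 0)]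
    exact F.transport_refl a
  have lift : (fun t => (⟨γ t, s t⟩ : F.Total)) = isCoveringMap_base.liftPath γ ⟨γ 0, a⟩ rfl :=
    (isCoveringMap_base.eq_liftPath_iff _).mpr ⟨continuous_s, rfl, congrArg (Total.mk _) s_zero⟩
  let ι : Path (0 : unitInterval) 1 := ⟨.id _, rfl, rfl⟩
  have s_one : s 1 = F.transport ((.mk ι : Quotient (0 : unitInterval) 1).map γ) a := by
    simp only [s]
    rw [Subsingleton.elim (c 1) (.mk ι)]
  exact Subtype.ext ((congrFun lift 1).symm.trans (congrArg (Total.mk _) s_one))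

variable (F) in
/-- The covering associated with a local system. -/
def toCov : Cov Y := ⟨F.Total, Total.base, isCoveringMap_base⟩

theorem fiberEquiv_monodromy {y y' : Y} (γ : Quotient y y')
    (z : (Total.base : F.Total → Y) ⁻¹' {y}) :
    fiberEquiv F y' (isCoveringMap_base.monodromy γ z) = F.transport γ (fiberEquiv F y z) := by
  obtain ⟨⟨y, a⟩, rfl⟩ := z
  exact congrArg (fiberEquiv F y') (monodromy_mk γ a)

variable (F) in
/-- The covering associated with a local system has that local system as its monodromy. -/
noncomputable def monodromyToCovIso : (Cov.monodromy Y).obj (LocalSystem.toCov F) ≅ F :=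
  NatIso.ofComponents (fun y => (fiberEquiv F y.as).toIso) fun γ => by
    ext z
    exact fiberEquiv_monodromy γ z

instance : (Cov.monodromy Y).EssSurj where
  mem_essImage F := ⟨LocalSystem.toCov F, ⟨monodromyToCovIso F⟩⟩

end LocalSystem

instance {X : Type*} [TopologicalSpace X] [PathConnectedSpace X] :
    IsConnected (FundamentalGroupoid X) :=
  have : Nonempty (FundamentalGroupoid X) := ⟨⟨Classical.arbitrary X⟩⟩
  zigzag_isConnected fun x x' => .of_hom (.mk (PathConnectedSpace.somePath x.as x'.as))

theorem mainTheorem4_general {X Y : Type u} [TopologicalSpace X] [TopologicalSpace Y]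
    [ConnectedSpace X] [LocallyPathConnectedSpace X]
    [ConnectedSpace Y] [LocallyPathConnectedSpace Y] [SemilocallySimplyConnectedSpace Y]
    (f : C(X, Y)) (x₀ : X) :
    Function.Surjective (FundamentalGroup.map f x₀) ↔ EssentiallyInjective (Cov.pullback f) := by
  have : PathConnectedSpace X := pathConnectedSpace_iff_connectedSpace.mpr inferInstance
  have : PathConnectedSpace Y := pathConnectedSpace_iff_connectedSpace.mpr inferInstance
  have : (Cov.monodromy Y).IsEquivalence := { }
  calc Function.Surjective (FundamentalGroup.map f x₀)
      ↔ (FundamentalGroupoid.map f).Full :=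
        (full_iff_surjective_map_loops (FundamentalGroupoid.map f) ⟨x₀⟩).symm
    _ ↔ EssentiallyInjective
          ((Functor.whiskeringLeft _ _ (Type u)).obj (FundamentalGroupoid.map f)) :=
        (essentiallyInjective_whiskeringLeft_iff_full _).symm
    _ ↔ EssentiallyInjective (Cov.pullback f) :=
        (essentiallyInjective_iff_of_comp_iso (Cov.pullbackCompMonodromyIso f)).symm

theorem mainTheorem4 {X Y : Type u} [TopologicalSpace X] [TopologicalSpace Y]
    [ConnectedSpace X] [LocallyPathConnectedSpace X] [SemilocallySimplyConnectedSpace X]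
    [ConnectedSpace Y] [LocallyPathConnectedSpace Y] [SemilocallySimplyConnectedSpace Y]
    (f : C(X, Y)) (x₀ : X) :
    Function.Surjective (FundamentalGroup.map f x₀) ↔ EssentiallyInjective (Cov.pullback f) :=
  mainTheorem4_general f x₀
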